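/- Let $p$ be a prime and let $v_p$, $|\cdot|_p$ be the $p$-adic valuation and absolute value on $\mathbb{Q}_p$ (so $|x|_p=p^{-v_p(x)}$ for $x\neq 0$). The Schneider map $T_p:p\mathbb{Z}_p\to p\mathbb{Z}_p$ is defined by $T_p(0)=0$ and, for $x\ne 0$, $T_p(x)=p^{a_1(x)}/x-b_1(x)$, where $a_1(x)=v_p(x)$ and $b_1(x)\in\{1,\dots,p-1\}$ is determined by $b_1(x)\equiv p^{a_1(x)}/x \pmod p$. Let $F=\bigcup_{k\ge 0}T_p^{-k}(0)$, let $\psi(x)=p^{a_1(x)}$ for $x\neq 0$, and put $a_i(x)=a_1(T_p^{i-1}x)$ for $x\in p\mathbb{Z}_p\setminus F$ and $i\ge 1$. For $\alpha\in\mathbb{R}$ let $$J_p(\alpha)=\Big\{x\in p\mathbb{Z}_p\setminus F:\ \lim_{n\to\infty}\frac1n\sum_{k=0}^{n-1}\log\psi(T_p^k x)=\alpha\Big\}$$ (membership includes the existence of the limit), and let $L_p(\alpha)=\dim_{\mathrm H}J_p(\alpha)$ be its Hausdorff dimension with respect to the $p$-adic metric. **Theorem.** For every $\alpha\ge\log p$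 the set $J_p(\alpha)$ is non-empty. For every $\alpha>\log p$, $$L_p(\alpha)=\frac{\log(p-1)+\log(\alpha-\log p)-\log\log p+\alpha\log_p\alpha-\alpha\log_p(\alpha-\log p)}{\alpha},$$ and at the endpoint $\alpha=\log p$, where this expression is to be read as its limit, $$L_p(\log p)=\frac{\log(p-1)}{\log p}.$$ Equivalently, for every real $\hat\alpha>1$, the set of $x\in p\mathbb{Z}_p\setminus F$ with $\lim_{n\to\infty}\frac1n\sum_{i=1}^n a_i(x)=\hat\alpha$ has Hausdorff dimension $$\frac{\hat\alpha\log\hat\alpha-(\hat\alpha-1)\log(\hat\alpha-1)+\log(p-1)}{\hat\alpha\log p},$$ and for $\hat\alpha=1$ its Hausdorff dimension is $\log(p-1)/\log p$. -/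

import Mathlib

open Filter Topology

noncomputable section

namespace Schneider

/-- The maximal ideal `pℤ_p`, as a subset of `ℚ_p`: all `x` with `|x|_p < 1`. -/
def pZp (p : ℕ) [Fact p.Prime] : Set ℚ_[p] := {x | ‖x‖ < 1}

/-- The first digit `a₁(x) = v_p(x)`. -/
def firstA (p : ℕ) [Fact p.Prime] (x : ℚ_[p]) : ℤ := x.valuation

/-- The first digit `b₁(x) ∈ {1, …, p - 1}`, determined for `x ≠ 0` by the congruence
`b₁(x) ≡ p ^ a₁(x) / x (mod p)`. (`existsUnique_firstB` and `firstB_spec` below show that for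
`x ≠ 0` the set is a singleton. At `x = 0` the value is irrelevant.) -/
def firstB (p : ℕ) [Fact p.Prime] (x : ℚ_[p]) : ℕ :=
  sInf {b : ℕ | 1 ≤ b ∧ b ≤ p - 1 ∧ ‖(p : ℚ_[p]) ^ firstA p x / x - (b : ℚ_[p])‖ < 1}

open Classical in
/-- The Schneider map: `T_p(0) = 0` and `T_p(x) = p ^ a₁(x) / x - b₁(x)` for `x ≠ 0`.
It maps `pℤ_p` to itself, see `mapsTo_schneiderMap`. -/
def schneiderMap (p : ℕ) [Fact p.Prime] (x : ℚ_[p]) : ℚ_[p] :=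
  if x = 0 then 0 else (p : ℚ_[p]) ^ firstA p x / x - (firstB p x : ℚ_[p])

/-- The digits of the Schneider continued fraction, indexed from zero:
`digitA p i x` is `a_{i+1}(x) = a₁(T_p^i x)`. -/
def digitA (p : ℕ) [Fact p.Prime] (i : ℕ) (x : ℚ_[p]) : ℤ :=
  firstA p ((schneiderMap p)^[i] x)

/-- The set `F` of the points of `pℤ_p` with a finite continued fraction expansion. -/
def finiteExpansion (p : ℕ) [Fact p.Prime] : Set ℚ_[p] :=
  {x | x ∈ pZp p ∧ ∃ n : ℕ, (schneiderMap p)^[n] x = 0}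

/-- The potential `ψ(x) = p ^ a₁(x)`. -/
def psi (p : ℕ) [Fact p.Prime] (x : ℚ_[p]) : ℝ := (p : ℝ) ^ firstA p x

/-- The Lyapunov exponent `lim_n (1/n) ∑_{k<n} log ψ(T_p^k x)` exists and is equal to `α`. -/
def HasLyapunovExponent (p : ℕ) [Fact p.Prime] (x : ℚ_[p]) (α : ℝ) : Prop :=
  Tendsto (fun n : ℕ => birkhoffAverage ℝ (schneiderMap p) (fun y => Real.log (psi p y)) n x)
    atTop (𝓝 α)

/-- The level set `J_p(α)` of the Lyapunov exponent. -/
def levelSet (p : ℕ) [Fact p.Prime] (α : ℝ) : Set ℚ_[p] :=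
  {x | x ∈ pZp p \ finiteExpansion p ∧ HasLyapunovExponent p x α}

/-- The Lyapunov spectrum `L_p(α)`: the Hausdorff dimension, in the `p`-adic metric,
of the level set `J_p(α)`. -/
def lyapunovSpectrum (p : ℕ) [Fact p.Prime] (α : ℝ) : ENNReal := dimH (levelSet p α)

/-- The points of `pℤ_p` with an infinite expansion whose digits `a₁, a₂, …` have asymptotic
arithmetic mean `m`. -/
def meanSet (p : ℕ) [Fact p.Prime] (m : ℝ) : Set ℚ_[p] :=
  {x | x ∈ pZp p \ finiteExpansion p ∧
    Tendsto (fun n : ℕ => (∑ i ∈ Finset.range n, (digitA p i x : ℝ)) / (n : ℝ)) atTop (𝓝 m)}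

theorem norm_unit_part (p : ℕ) [Fact p.Prime] {x : ℚ_[p]} (hx : x ≠ 0) :
    ‖(p : ℚ_[p]) ^ firstA p x / x‖ = 1 := by
  have hp : (p : ℝ) ≠ 0 := by exact_mod_cast (Fact.out : p.Prime).ne_zero
  rw [norm_div, Padic.norm_p_zpow, Padic.norm_eq_zpow_neg_valuation hx, firstA]
  exact div_self (zpow_ne_zero _ hp)

theorem existsUnique_firstB (p : ℕ) [Fact p.Prime] {x : ℚ_[p]} (hx : x ≠ 0) :
    ∃! b : ℕ, 1 ≤ b ∧ b ≤ p - 1 ∧ ‖(p : ℚ_[p]) ^ firstA p x / x - (b : ℚ_[p])‖ < 1 := by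
  have hu := norm_unit_part p hx
  set u : ℚ_[p] := (p : ℚ_[p]) ^ firstA p x / x with hu_def
  have hp : p.Prime := Fact.out
  let y : ℤ_[p] := ⟨u, hu.le⟩
  obtain ⟨b, ⟨hb, hyb⟩, huniq⟩ := PadicInt.existsUnique_mem_range (p := p) y
  have key : ∀ c : ℕ, ‖u - (c : ℚ_[p])‖ < 1 ↔
      y - (c : ℤ_[p]) ∈ IsLocalRing.maximalIdeal ℤ_[p] := by
    intro c
    rw [IsLocalRing.mem_maximalIdeal, PadicInt.mem_nonunits, PadicInt.norm_def,
      PadicInt.coe_sub, PadicInt.coe_natCast]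
  refine ⟨b, ⟨?_, by omega, (key b).2 hyb⟩, ?_⟩
  · rcases Nat.eq_zero_or_pos b with h | h
    · have := (key b).2 hyb
      rw [h] at this
      simp [hu] at this
    · exact h
  · rintro c ⟨hc1, hc2, hc3⟩
    exact huniq c ⟨by have := hp.one_lt; omega, (key c).1 hc3⟩

theorem firstB_spec (p : ℕ) [Fact p.Prime] {x : ℚ_[p]} (hx : x ≠ 0) :
    1 ≤ firstB p x ∧ firstB p x ≤ p - 1 ∧
      ‖(p : ℚ_[p]) ^ firstA p x / x - (firstB p x : ℚ_[p])‖ < 1 :=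
  Nat.sInf_mem (s := {b : ℕ | 1 ≤ b ∧ b ≤ p - 1 ∧
    ‖(p : ℚ_[p]) ^ firstA p x / x - (b : ℚ_[p])‖ < 1}) (existsUnique_firstB p hx).exists

theorem mapsTo_schneiderMap (p : ℕ) [Fact p.Prime] :
    Set.MapsTo (schneiderMap p) (pZp p) (pZp p) := by
  intro x _
  by_cases hx : x = 0
  · simp [schneiderMap, hx, pZp]
  · simpa [schneiderMap, hx, pZp] using (firstB_spec p hx).2.2

end Schneider

end

/-!
Write the continued fraction digits `(a₁, b₁), (a₂, b₂), …` of a point of `pℤ_p` as the string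
`0^(a₁-1) b₁ 0^(a₂-1) b₂ ⋯` of digits in `{0, …, p - 1}`. This coding (`Schneider.code`) is
isometric: two points share their first `n` digits exactly when their distance is less than
`p ^ (-n)` (`Schneider.forall_code_eq_iff`), because on each of its branches the map
`Schneider.shift`, which removes one digit, multiplies distances by `p`. Every digit string occurs
(`Schneider.exists_code_eq`). The `k`-th nonzero digit stands at the place `a₁ + ⋯ + a_k`, so the
mean of the `a_i` is `m` exactly when the nonzero digits have density `1 / m`
(`Schneider.mem_meanSet_iff`), and the Lyapunov exponent is `m log p`.

The theorem thus becomes a theorem of Besicovitch and Eggleston: the strings whose nonzero digits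
have density `δ` form a set of dimension `H / log p`, where `H = Real.qaryEntropy p δ`
(`Schneider.dimH_densitySet`). Give the digit `0` the weight `1 - δ` and every other digit the
weight `δ / (p - 1)`. Around each string of the set the cylinder of rank `n` has mass
`exp (-n (H + o(1)))`. At most `p ^ (n s)` cylinders have mass at least `p ^ (-n s)`, which gives
the upper bound (`Schneider.dimH_le_of_le_prod`). By the strong law of large numbers the Bernoulli
measure is carried by the set, which is therefore nonempty, and the mass distribution principle
gives the lower bound (`Schneider.le_dimH_of_prod_le`). For `δ = 1` the digit `0` has weight `0`;
the lower bound is unaffected, and the upper bound is the limit of those from the weights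
`1 - t` and `t / (p - 1)` as `t` increases to `1`.
-/

namespace Schneider

variable (p : ℕ) [Fact p.Prime]

/-! ### The digit coding of `pℤ_p` -/

theorem one_lt_cast_prime : (1 : ℝ) < p := by exact_mod_cast (Fact.out : p.Prime).one_lt

theorem cast_prime_pos : (0 : ℝ) < p := zero_lt_one.trans (one_lt_cast_prime p)

theorem padic_cast_prime_ne_zero : (p : ℚ_[p]) ≠ 0 := by
  exact_mod_cast (Fact.out : p.Prime).ne_zero

theorem firstA_eq_of_norm_eq {x : ℚ_[p]} {n : ℤ} (hx : ‖x‖ = (p : ℝ) ^ (-n)) :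
    firstA p x = n := by
  have h0 : x ≠ 0 := by
    rw [← norm_pos_iff, hx]
    exact zpow_pos (cast_prime_pos p) _
  rw [Padic.norm_eq_zpow_neg_valuation h0] at hx
  have := zpow_right_injective₀ (cast_prime_pos p) (one_lt_cast_prime p).ne' hx
  exact neg_injective this

theorem firstB_lt {x : ℚ_[p]} (hx : x ≠ 0) : firstB p x < p := by
  have := (firstB_spec p hx).2.1
  have := (Fact.out : p.Prime).one_lt
  omega

theorem ne_zero_of_norm_eq_inv {x : ℚ_[p]} (hx : ‖x‖ = (p : ℝ)⁻¹) : x ≠ 0 := by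
  rw [← norm_pos_iff, hx]
  exact inv_pos.2 (cast_prime_pos p)

theorem firstA_eq_one {x : ℚ_[p]} (hx : ‖x‖ = (p : ℝ)⁻¹) : firstA p x = 1 :=
  firstA_eq_of_norm_eq p (by rw [hx, zpow_neg_one])

theorem firstB_eq_of_norm_sub_lt {x : ℚ_[p]} (hx : x ≠ 0) {b : ℕ} (hb : 1 ≤ b) (hbp : b < p)
    (h : ‖(p : ℚ_[p]) ^ firstA p x / x - (b : ℚ_[p])‖ < 1) : firstB p x = b :=
  (existsUnique_firstB p hx).unique (firstB_spec p hx) ⟨hb, by omega, h⟩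

open Classical in
/-- The first digit of the coding of `pℤ_p` by sequences in `{0, …, p - 1}` which writes the
continued fraction digits `(a₁, b₁), (a₂, b₂), …` as the string `0^(a₁-1) b₁ 0^(a₂-1) b₂ ⋯`.
It is `b₁(x)` if `|x| = 1/p` and `0` if `|x| < 1/p`. -/
noncomputable def leadingDigit (x : ℚ_[p]) : Fin p :=
  if h : ‖x‖ = (p : ℝ)⁻¹ then ⟨firstB p x, firstB_lt p (ne_zero_of_norm_eq_inv p h)⟩
  else ⟨0, (Fact.out : p.Prime).pos⟩

open Classical in
/-- The map which removes the first digit of the coding given by `leadingDigit`. It agrees with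
the Schneider map where `|x| = 1/p`, and is division by `p` elsewhere. -/
noncomputable def shift (x : ℚ_[p]) : ℚ_[p] :=
  if ‖x‖ = (p : ℝ)⁻¹ then (p : ℚ_[p]) / x - firstB p x else x / p

/-- The sequence of digits of `x` in the coding given by `leadingDigit` and `shift`. -/
noncomputable def code (x : ℚ_[p]) (i : ℕ) : Fin p := leadingDigit p ((shift p)^[i] x)

theorem leadingDigit_val_ne_zero_iff {x : ℚ_[p]} :
    (leadingDigit p x : ℕ) ≠ 0 ↔ ‖x‖ = (p : ℝ)⁻¹ := by
  unfold leadingDigit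
  split_ifs with h
  · have := (firstB_spec p (ne_zero_of_norm_eq_inv p h)).1
    simp only [ne_eq, h, iff_true]
    omega
  · simp [h]

theorem leadingDigit_val_of_norm_eq {x : ℚ_[p]} (h : ‖x‖ = (p : ℝ)⁻¹) :
    (leadingDigit p x : ℕ) = firstB p x := by
  simp [leadingDigit, h]

theorem shift_of_norm_eq {x : ℚ_[p]} (h : ‖x‖ = (p : ℝ)⁻¹) :
    shift p x = schneiderMap p x := by
  simp [shift, schneiderMap, h, ne_zero_of_norm_eq_inv p h, firstA_eq_one p h]

theorem shift_of_norm_ne {x : ℚ_[p]} (h : ‖x‖ ≠ (p : ℝ)⁻¹) : shift p x = x / p := by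
  simp [shift, h]

theorem norm_le_inv_of_mem_pZp {x : ℚ_[p]} (hx : x ∈ pZp p) : ‖x‖ ≤ (p : ℝ)⁻¹ := by
  have := (Padic.norm_lt_pow_iff_norm_le_pow_sub_one x 0).1 (by simpa [pZp] using hx)
  simpa [zpow_neg_one] using this

theorem norm_div_cast_prime (x : ℚ_[p]) : ‖x / p‖ = p * ‖x‖ := by
  rw [norm_div, Padic.norm_p, div_inv_eq_mul, mul_comm]

theorem norm_shift_sub_shift {x y : ℚ_[p]} (h : leadingDigit p x = leadingDigit p y) :
    ‖shift p x - shift p y‖ = p * ‖x - y‖ := by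
  have hp := cast_prime_pos p
  by_cases hx : ‖x‖ = (p : ℝ)⁻¹
  · have hy : ‖y‖ = (p : ℝ)⁻¹ := by
      rw [← leadingDigit_val_ne_zero_iff, ← h, leadingDigit_val_ne_zero_iff]
      exact hx
    have hb : firstB p x = firstB p y := by
      rw [← leadingDigit_val_of_norm_eq p hx, ← leadingDigit_val_of_norm_eq p hy, h]
    have hx0 := ne_zero_of_norm_eq_inv p hx
    have hy0 := ne_zero_of_norm_eq_inv p hy
    have : shift p x - shift p y = -((p : ℚ_[p]) * (x - y) / (x * y)) := by
      rw [shift, if_pos hx, shift, if_pos hy, hb]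
      field_simp
      ring
    rw [this, norm_neg, norm_div, norm_mul, norm_mul, hx, hy, Padic.norm_p]
    field_simp
  · have hy : ¬ ‖y‖ = (p : ℝ)⁻¹ := by
      rw [← leadingDigit_val_ne_zero_iff, ← h, leadingDigit_val_ne_zero_iff]
      exact hx
    rw [shift_of_norm_ne p hx, shift_of_norm_ne p hy, ← sub_div, norm_div_cast_prime]

theorem leadingDigit_eq_of_norm_sub_lt {x y : ℚ_[p]} (h : ‖x - y‖ < (p : ℝ)⁻¹) :
    leadingDigit p x = leadingDigit p y := by
  have hp := cast_prime_pos p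
  have hxy : ‖x‖ = (p : ℝ)⁻¹ ↔ ‖y‖ = (p : ℝ)⁻¹ := by
    constructor
    · intro hx
      exact (Padic.norm_eq_of_norm_sub_lt_left (hx ▸ h)).symm.trans hx
    · intro hy
      exact (Padic.norm_eq_of_norm_sub_lt_right (hy ▸ h)).trans hy
  by_cases hx : ‖x‖ = (p : ℝ)⁻¹
  · have hy := hxy.1 hx
    have hx0 := ne_zero_of_norm_eq_inv p hx
    have hy0 := ne_zero_of_norm_eq_inv p hy
    apply Fin.ext
    rw [leadingDigit_val_of_norm_eq p hx, leadingDigit_val_of_norm_eq p hy]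
    obtain ⟨h1, -, h2⟩ := firstB_spec p hy0
    refine firstB_eq_of_norm_sub_lt p hx0 h1 (firstB_lt p hy0) ?_
    rw [firstA_eq_one p hy] at h2
    rw [firstA_eq_one p hx]
    have hd : ‖(p : ℚ_[p]) ^ (1 : ℤ) / x - (p : ℚ_[p]) ^ (1 : ℤ) / y‖ < 1 := by
      have : (p : ℚ_[p]) ^ (1 : ℤ) / x - (p : ℚ_[p]) ^ (1 : ℤ) / y
          = -((p : ℚ_[p]) * (x - y) / (x * y)) := by
        rw [zpow_one]
        field_simp
        ring
      rw [this, norm_neg, norm_div, norm_mul, norm_mul, hx, hy, Padic.norm_p]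
      calc (p : ℝ)⁻¹ * ‖x - y‖ / ((p : ℝ)⁻¹ * (p : ℝ)⁻¹) = p * ‖x - y‖ := by field_simp
        _ < p * (p : ℝ)⁻¹ := by gcongr
        _ = 1 := mul_inv_cancel₀ hp.ne'
    have := (Padic.nonarchimedean _ _).trans_lt (max_lt hd h2)
    simpa using this
  · have hy : ¬ ‖y‖ = (p : ℝ)⁻¹ := fun hy => hx (hxy.2 hy)
    simp [leadingDigit, hx, hy]

theorem shift_mem_pZp {x : ℚ_[p]} (hx : x ∈ pZp p) : shift p x ∈ pZp p := by
  by_cases h : ‖x‖ = (p : ℝ)⁻¹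
  · rw [shift_of_norm_eq p h]
    exact mapsTo_schneiderMap p hx
  · rw [shift_of_norm_ne p h]
    have h1 := (norm_le_inv_of_mem_pZp p hx).lt_of_ne h
    change ‖x / p‖ < 1
    rw [norm_div_cast_prime]
    calc (p : ℝ) * ‖x‖ < p * (p : ℝ)⁻¹ := by gcongr; exact cast_prime_pos p
      _ = 1 := mul_inv_cancel₀ (cast_prime_pos p).ne'

theorem norm_sub_lt_one {x y : ℚ_[p]} (hx : x ∈ pZp p) (hy : y ∈ pZp p) : ‖x - y‖ < 1 := by
  have := Padic.nonarchimedean x (-y)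
  rw [norm_neg, ← sub_eq_add_neg] at this
  exact this.trans_lt (max_lt hx hy)

theorem code_succ (x : ℚ_[p]) (i : ℕ) : code p x (i + 1) = code p (shift p x) i := rfl

theorem code_add (x : ℚ_[p]) (m i : ℕ) :
    code p x (m + i) = code p ((shift p)^[m] x) i := by
  rw [code, code, add_comm, Function.iterate_add_apply]

/-- The coding is isometric: two points share their first `n` digits exactly when their distance
is less than `p ^ (-n)`. -/
theorem forall_code_eq_iff (n : ℕ) {x y : ℚ_[p]} (hx : x ∈ pZp p) (hy : y ∈ pZp p) :
    (∀ i < n, code p x i = code p y i) ↔ ‖x - y‖ < ((p : ℝ)⁻¹) ^ n := by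
  have hp := cast_prime_pos p
  induction n generalizing x y with
  | zero => simpa using norm_sub_lt_one p hx hy
  | succ n ih =>
    rw [Nat.forall_lt_succ_left']
    have h1 : ((p : ℝ)⁻¹) ^ (n + 1) ≤ (p : ℝ)⁻¹ :=
      pow_le_of_le_one (by positivity) (inv_le_one_of_one_le₀ (one_lt_cast_prime p).le) (by simp)
    have key : leadingDigit p x = leadingDigit p y →
        (‖shift p x - shift p y‖ < ((p : ℝ)⁻¹) ^ n ↔ ‖x - y‖ < ((p : ℝ)⁻¹) ^ (n + 1)) := by
      intro h
      rw [norm_shift_sub_shift p h, pow_succ, ← div_eq_mul_inv, lt_div_iff₀ hp, mul_comm]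
    have ih' := ih (shift_mem_pZp p hx) (shift_mem_pZp p hy)
    constructor
    · rintro ⟨h0, h⟩
      exact (key h0).1 (ih'.1 h)
    · intro h
      have h0 := leadingDigit_eq_of_norm_sub_lt p (h.trans_le h1)
      exact ⟨h0, ih'.2 ((key h0).2 h)⟩

theorem exists_leadingDigit_eq_shift_eq (b : Fin p) {y : ℚ_[p]} (hy : y ∈ pZp p) :
    ∃ x ∈ pZp p, leadingDigit p x = b ∧ shift p x = y := by
  have hp := cast_prime_pos p
  have hp0 := padic_cast_prime_ne_zero p
  have hp1 : (p : ℝ)⁻¹ < 1 := inv_lt_one_of_one_lt₀ (one_lt_cast_prime p)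
  by_cases hb : (b : ℕ) = 0
  · have hlt : ‖(p : ℚ_[p]) * y‖ < (p : ℝ)⁻¹ := by
      rw [norm_mul, Padic.norm_p]
      exact mul_lt_of_lt_one_right (inv_pos.2 hp) hy
    refine ⟨p * y, hlt.trans hp1, ?_, ?_⟩
    · apply Fin.ext
      rw [hb]
      by_contra h
      exact hlt.ne ((leadingDigit_val_ne_zero_iff p).1 h)
    · rw [shift_of_norm_ne p hlt.ne]
      field_simp
  · have hbn : ‖((b : ℕ) : ℚ_[p])‖ = 1 := by
      rw [Padic.norm_natCast_eq_one_iff]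
      exact ((Nat.Prime.coprime_iff_not_dvd Fact.out).2
        (Nat.not_dvd_of_pos_of_lt (Nat.pos_of_ne_zero hb) b.2))
    have hby : ‖((b : ℕ) : ℚ_[p]) + y‖ = 1 := by
      rw [Padic.add_eq_max_of_ne (by rw [hbn]; exact (show ‖y‖ < 1 from hy).ne'), hbn]
      exact max_eq_left (show ‖y‖ < 1 from hy).le
    have hne : ((b : ℕ) : ℚ_[p]) + y ≠ 0 := by
      rw [← norm_pos_iff, hby]
      exact one_pos
    set x : ℚ_[p] := p / ((b : ℕ) + y) with hx
    have hxn : ‖x‖ = (p : ℝ)⁻¹ := by rw [hx, norm_div, hby, Padic.norm_p, div_one]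
    have hpx : (p : ℚ_[p]) / x = (b : ℕ) + y := by rw [hx, div_div_cancel₀ hp0]
    have hB : firstB p x = b := by
      refine firstB_eq_of_norm_sub_lt p (ne_zero_of_norm_eq_inv p hxn)
        (Nat.pos_of_ne_zero hb) b.2 ?_
      rw [firstA_eq_one p hxn, zpow_one, hpx, add_sub_cancel_left]
      exact hy
    refine ⟨x, by rw [pZp, Set.mem_ofPred_eq, hxn]; exact hp1, ?_, ?_⟩
    · apply Fin.ext
      rw [leadingDigit_val_of_norm_eq p hxn, hB]
    · rw [shift, if_pos hxn, hpx, hB, add_sub_cancel_left]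

theorem exists_forall_lt_code_eq (w : ℕ → Fin p) (n : ℕ) :
    ∃ x ∈ pZp p, ∀ i < n, code p x i = w i := by
  induction n generalizing w with
  | zero => exact ⟨0, by simp [pZp], by simp⟩
  | succ n ih =>
    obtain ⟨y, hy, hyw⟩ := ih fun i => w (i + 1)
    obtain ⟨x, hx, hd, hs⟩ := exists_leadingDigit_eq_shift_eq p (w 0) hy
    refine ⟨x, hx, ?_⟩
    rw [Nat.forall_lt_succ_left']
    refine ⟨hd, fun i hi => ?_⟩
    rw [code_succ, hs, hyw i hi]

theorem exists_code_eq (w : ℕ → Fin p) : ∃ x ∈ pZp p, code p x = w := by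
  have hp1 : (p : ℝ)⁻¹ < 1 := inv_lt_one_of_one_lt₀ (one_lt_cast_prime p)
  choose u hu huw using exists_forall_lt_code_eq p w
  have hdist : ∀ m n, m ≤ n → ‖u m - u n‖ < ((p : ℝ)⁻¹) ^ m := fun m n hmn =>
    (forall_code_eq_iff p m (hu m) (hu n)).1 fun i hi => by
      rw [huw m i hi, huw n i (hi.trans_le hmn)]
  have hc : CauchySeq u := by
    refine cauchySeq_of_le_geometric (p : ℝ)⁻¹ 1 hp1 fun n => ?_
    rw [dist_eq_norm, one_mul]
    exact (hdist n (n + 1) n.le_succ).le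
  obtain ⟨x, hx⟩ := cauchySeq_tendsto_of_complete hc
  -- A term of large index close to the limit shares with it as many digits as desired.
  have hlim : ∀ n, ∃ m, n ≤ m ∧ ‖x - u m‖ < ((p : ℝ)⁻¹) ^ n := by
    intro n
    have h1 := (Metric.tendsto_atTop.1 hx (((p : ℝ)⁻¹) ^ n)
      (pow_pos (inv_pos.2 (cast_prime_pos p)) n))
    obtain ⟨M, hM⟩ := h1
    refine ⟨max n M, le_max_left _ _, ?_⟩
    rw [← dist_eq_norm, dist_comm]
    exact hM _ (le_max_right _ _)
  have hxm : x ∈ pZp p := by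
    obtain ⟨m, -, hm⟩ := hlim 0
    have := (Padic.nonarchimedean (x - u m) (u m)).trans_lt
      (max_lt (by simpa using hm) (hu m))
    simpa [pZp] using this
  refine ⟨x, hxm, funext fun i => ?_⟩
  obtain ⟨m, hnm, hm⟩ := hlim (i + 1)
  rw [(forall_code_eq_iff p (i + 1) hxm (hu m)).2 hm i i.lt_succ_self]
  exact huw m i hnm

end Schneider

/-! ### Counting functions and their inverses -/

/-- If `N` inverts the strictly increasing sequence `A` of the positions of a set of integers, then
the set has density `δ > 0` only if `A k / k` tends to `1 / δ`. -/
theorem tendsto_position_div_of_tendsto_count_div {A N : ℕ → ℕ} (hA : StrictMono A)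
    (hN : ∀ k, N (A k) = k) {δ : ℝ} (hδ : δ ≠ 0)
    (h : Tendsto (fun n : ℕ => (N n : ℝ) / n) atTop (𝓝 δ)) :
    Tendsto (fun k : ℕ => (A k : ℝ) / k) atTop (𝓝 δ⁻¹) := by
  refine ((h.comp hA.tendsto_atTop).inv₀ hδ).congr fun k => ?_
  simp [hN]

/-- If the monotone `N` inverts the sequence `A` of the positions of a set of integers, and
`A k / k` tends to `m > 0`, then the set has density `1 / m`. -/
theorem tendsto_count_div_of_tendsto_position_div {A N : ℕ → ℕ}
    (hNm : Monotone N) (hN : ∀ k, N (A k) = k) {m : ℝ} (hm : m ≠ 0)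
    (h : Tendsto (fun k : ℕ => (A k : ℝ) / k) atTop (𝓝 m)) :
    Tendsto (fun n : ℕ => (N n : ℝ) / n) atTop (𝓝 m⁻¹) := by
  have hNt : Tendsto N atTop atTop :=
    tendsto_atTop_atTop.2 fun b => ⟨A b, fun n hn => (hN b).symm.le.trans (hNm hn)⟩
  -- `A (N n)` itself may exceed `n`, so the lower bound uses `A (N n - 1)`.
  have hup : ∀ n, n ≤ A (N n + 1) := fun n => by
    by_contra! hlt
    have := hNm hlt.le
    rw [hN] at this
    omega
  have hlo : ∀ n, 1 ≤ N n → A (N n - 1) ≤ n := fun n hn => by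
    by_contra! hlt
    have := hNm hlt.le
    rw [hN] at this
    omega
  have hone : Tendsto (fun k : ℕ => ((k + 1 : ℕ) : ℝ) / k) atTop (𝓝 1) := by
    have h1 : Tendsto (fun k : ℕ => 1 + 1 / (k : ℝ)) atTop (𝓝 (1 + 0)) :=
      tendsto_const_nhds.add tendsto_one_div_atTop_nhds_zero_nat
    rw [add_zero] at h1
    refine h1.congr' ?_
    filter_upwards [eventually_gt_atTop 0] with k hk
    have : (k : ℝ) ≠ 0 := by positivity
    push_cast
    field_simp
  have hU : Tendsto (fun k : ℕ => (A (k + 1) : ℝ) / k) atTop (𝓝 m) := by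
    have h1 := (h.comp (tendsto_add_atTop_nat 1)).mul hone
    rw [mul_one] at h1
    refine h1.congr fun k => ?_
    have : ((k + 1 : ℕ) : ℝ) ≠ 0 := by positivity
    simp only [Function.comp]
    field_simp
  have hL : Tendsto (fun k : ℕ => (A (k - 1) : ℝ) / k) atTop (𝓝 m) := by
    rw [← tendsto_add_atTop_iff_nat 1]
    have h1 := h.mul (hone.inv₀ one_ne_zero)
    rw [inv_one, mul_one] at h1
    refine h1.congr' ?_
    filter_upwards [eventually_gt_atTop 0] with k hk
    have : (k : ℝ) ≠ 0 := by positivity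
    rw [Nat.add_sub_cancel]
    field_simp
  have hmid : Tendsto (fun n : ℕ => (n : ℝ) / N n) atTop (𝓝 m) := by
    refine tendsto_of_tendsto_of_tendsto_of_le_of_le' (hL.comp hNt) (hU.comp hNt) ?_ ?_
    · filter_upwards [hNt.eventually_ge_atTop 1] with n hn
      simp only [Function.comp]
      gcongr
      exact hlo n hn
    · filter_upwards with n
      simp only [Function.comp]
      gcongr
      exact hup n
  refine (hmid.inv₀ hm).congr fun n => inv_div _ _

namespace Schneider

variable (p : ℕ) [Fact p.Prime]

/-! ### Mean digits and the density of the nonzero code digits -/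

/-- The number of nonzero digits among the first `n` digits of the sequence `w`. -/
def nonzeroCount {p : ℕ} (w : ℕ → Fin p) (n : ℕ) : ℕ := Nat.count (fun i => (w i : ℕ) ≠ 0) n

theorem nonzeroCount_code_add (x : ℚ_[p]) (m n : ℕ) :
    nonzeroCount (code p x) (m + n)
      = nonzeroCount (code p x) m + nonzeroCount (code p ((shift p)^[m] x)) n := by
  simp only [nonzeroCount, Nat.count_add, code_add]

theorem shift_zero : shift p 0 = 0 := by
  rw [shift_of_norm_ne p (by simpa using (cast_prime_pos p).ne), zero_div]

theorem nonzeroCount_code_zero (n : ℕ) : nonzeroCount (code p 0) n = 0 := by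
  rw [nonzeroCount, Nat.count_iff_forall_not]
  intro i _
  rw [not_not, code, Function.iterate_fixed (shift_zero p)]
  by_contra h
  have := (leadingDigit_val_ne_zero_iff p).1 h
  rw [norm_zero] at this
  exact (inv_pos.2 (cast_prime_pos p)).ne this

theorem schneiderMap_div_cast_prime {x : ℚ_[p]} (hx : x ≠ 0) :
    schneiderMap p (x / p) = schneiderMap p x := by
  have hp := padic_cast_prime_ne_zero p
  have hA : firstA p (x / p) = firstA p x - 1 := by
    rw [firstA, firstA, div_eq_mul_inv, Padic.valuation_mul hx (inv_ne_zero hp),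
      Padic.valuation_inv, Padic.valuation_p]
    ring
  have hq : (p : ℚ_[p]) ^ firstA p (x / p) / (x / p) = (p : ℚ_[p]) ^ firstA p x / x := by
    rw [hA, zpow_sub_one₀ hp]
    field_simp
  have hB : firstB p (x / p) = firstB p x := by rw [firstB, firstB, hq]
  rw [schneiderMap, schneiderMap, if_neg hx, if_neg (div_ne_zero hx hp), hq, hB]

/-- The continued fraction digit `(a₁, b₁)` occupies `a₁` places of the code, of which only the
last is nonzero; removing these places is the Schneider map. -/
theorem iterate_shift_of_norm_eq (n : ℕ) {x : ℚ_[p]} (hx : ‖x‖ = ((p : ℝ)⁻¹) ^ (n + 1)) :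
    (shift p)^[n + 1] x = schneiderMap p x ∧ nonzeroCount (code p x) (n + 1) = 1 := by
  have hp := cast_prime_pos p
  induction n generalizing x with
  | zero =>
    rw [zero_add, pow_one] at hx
    refine ⟨shift_of_norm_eq p hx, ?_⟩
    rw [nonzeroCount, zero_add, Nat.count_one, if_pos]
    exact (leadingDigit_val_ne_zero_iff p).2 hx
  | succ n ih =>
    have hne : ‖x‖ ≠ (p : ℝ)⁻¹ := by
      rw [hx]
      refine (pow_lt_self_of_lt_one₀ (inv_pos.2 hp) ?_ (by omega)).ne
      exact inv_lt_one_of_one_lt₀ (one_lt_cast_prime p)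
    have hx0 : x ≠ 0 := by
      rw [← norm_pos_iff, hx]
      positivity
    have hs := shift_of_norm_ne p hne
    have hd : ¬ (code p x 0 : ℕ) ≠ 0 := fun h => hne ((leadingDigit_val_ne_zero_iff p).1 h)
    obtain ⟨h1, h2⟩ := ih (x := x / p) (by
      rw [norm_div_cast_prime, hx, pow_succ' _ (n + 1), mul_inv_cancel_left₀ hp.ne'])
    constructor
    · rw [Function.iterate_succ_apply, hs, h1, schneiderMap_div_cast_prime p hx0]
    · rw [add_comm (n + 1) 1, nonzeroCount_code_add, Function.iterate_one, hs, h2,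
        nonzeroCount, Nat.count_one, if_neg hd]

theorem exists_firstA_eq {x : ℚ_[p]} (hx : x ∈ pZp p) (h0 : x ≠ 0) :
    ∃ n : ℕ, firstA p x = (n + 1 : ℕ) ∧ ‖x‖ = ((p : ℝ)⁻¹) ^ (n + 1) := by
  have hn := Padic.norm_eq_zpow_neg_valuation h0
  have hpos : 0 < x.valuation := by
    by_contra! hle
    have : (1 : ℝ) ≤ ‖x‖ := by
      rw [hn]
      exact one_le_zpow₀ (one_lt_cast_prime p).le (by omega)
    exact absurd hx (by simpa [pZp] using this)
  refine ⟨x.valuation.toNat - 1, ?_, ?_⟩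
  · rw [firstA]
    omega
  · rw [hn, zpow_neg, inv_pow, ← zpow_natCast]
    congr 2
    omega

theorem iterate_schneiderMap_mem (k : ℕ) {x : ℚ_[p]} (hx : x ∈ pZp p) :
    (schneiderMap p)^[k] x ∈ pZp p := (mapsTo_schneiderMap p).iterate k hx

theorem exists_iterate_shift_eq (k : ℕ) {x : ℚ_[p]} (hx : x ∈ pZp p) :
    ∃ n, (shift p)^[n] x = (schneiderMap p)^[k] x := by
  induction k with
  | zero => exact ⟨0, rfl⟩
  | succ k ih =>
    obtain ⟨n, hn⟩ := ih
    by_cases h0 : (schneiderMap p)^[k] x = 0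
    · refine ⟨n, ?_⟩
      rw [Function.iterate_succ_apply', hn, h0, schneiderMap, if_pos rfl]
    · obtain ⟨a, -, ha⟩ := exists_firstA_eq p (iterate_schneiderMap_mem p k hx) h0
      refine ⟨(a + 1) + n, ?_⟩
      rw [Function.iterate_add_apply, hn, (iterate_shift_of_norm_eq p a ha).1,
        Function.iterate_succ_apply']

/-- A point with a finite expansion has only finitely many nonzero code digits. -/
theorem notMem_finiteExpansion_of_tendsto {x : ℚ_[p]} {δ : ℝ} (hδ : δ ≠ 0)
    (h : Tendsto (fun n : ℕ => (nonzeroCount (code p x) n : ℝ) / n) atTop (𝓝 δ)) :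
    x ∉ finiteExpansion p := by
  rintro ⟨hx, k, hk⟩
  obtain ⟨n, hn⟩ := exists_iterate_shift_eq p k hx
  rw [hk] at hn
  have hz : Tendsto (fun j : ℕ => (nonzeroCount (code p x) n : ℝ) / j) atTop (𝓝 0) :=
    tendsto_const_nhds.div_atTop tendsto_natCast_atTop_atTop
  refine hδ (tendsto_nhds_unique h (hz.congr' ?_))
  filter_upwards [eventually_ge_atTop n] with j hj
  obtain ⟨i, rfl⟩ := Nat.exists_eq_add_of_le hj
  rw [nonzeroCount_code_add, hn, nonzeroCount_code_zero, add_zero]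

/-- The position in the code of `x` which follows the `k`-th continued fraction digit. -/
noncomputable def blockEnd (x : ℚ_[p]) (k : ℕ) : ℕ :=
  ∑ i ∈ Finset.range k, (digitA p i x).toNat

theorem exists_digitA_eq {x : ℚ_[p]} (hx : x ∈ pZp p \ finiteExpansion p) (k : ℕ) :
    ∃ n : ℕ, digitA p k x = (n + 1 : ℕ) ∧
      ‖(schneiderMap p)^[k] x‖ = ((p : ℝ)⁻¹) ^ (n + 1) :=
  exists_firstA_eq p (iterate_schneiderMap_mem p k hx.1) fun h => hx.2 ⟨hx.1, k, h⟩

theorem cast_blockEnd {x : ℚ_[p]} (hx : x ∈ pZp p \ finiteExpansion p) (k : ℕ) :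
    (blockEnd p x k : ℝ) = ∑ i ∈ Finset.range k, (digitA p i x : ℝ) := by
  rw [blockEnd, Nat.cast_sum]
  refine Finset.sum_congr rfl fun i _ => ?_
  obtain ⟨n, hn, -⟩ := exists_digitA_eq p hx i
  rw [hn, Int.toNat_natCast, Int.cast_natCast]

theorem strictMono_blockEnd {x : ℚ_[p]} (hx : x ∈ pZp p \ finiteExpansion p) :
    StrictMono (blockEnd p x) := by
  refine strictMono_nat_of_lt_succ fun k => ?_
  obtain ⟨n, hn, -⟩ := exists_digitA_eq p hx k
  rw [blockEnd, blockEnd, Finset.sum_range_succ, hn, Int.toNat_natCast]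
  omega

theorem iterate_shift_blockEnd {x : ℚ_[p]} (hx : x ∈ pZp p \ finiteExpansion p) (k : ℕ) :
    (shift p)^[blockEnd p x k] x = (schneiderMap p)^[k] x ∧
      nonzeroCount (code p x) (blockEnd p x k) = k := by
  induction k with
  | zero => simp [blockEnd, nonzeroCount]
  | succ k ih =>
    obtain ⟨n, hn, hnorm⟩ := exists_digitA_eq p hx k
    have hb : blockEnd p x (k + 1) = blockEnd p x k + (n + 1) := by
      rw [blockEnd, blockEnd, Finset.sum_range_succ, hn, Int.toNat_natCast]
    obtain ⟨h1, h2⟩ := iterate_shift_of_norm_eq p n hnorm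
    constructor
    · rw [hb, add_comm, Function.iterate_add_apply, ih.1, h1, Function.iterate_succ_apply']
    · rw [hb, nonzeroCount_code_add, ih.1, ih.2, h2]

/-- The digits `a₁, a₂, …` have mean `m` exactly when the nonzero digits of the code have
density `1 / m`. -/
theorem mem_meanSet_iff {m : ℝ} (hm : 0 < m) {x : ℚ_[p]} :
    x ∈ meanSet p m ↔ x ∈ pZp p ∧
      Tendsto (fun n : ℕ => (nonzeroCount (code p x) n : ℝ) / n) atTop (𝓝 m⁻¹) := by
  constructor
  · rintro ⟨hx, h⟩
    refine ⟨hx.1, tendsto_count_div_of_tendsto_position_div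
      (Nat.count_monotone _) (fun k => (iterate_shift_blockEnd p hx k).2) hm.ne' ?_⟩
    simpa only [cast_blockEnd p hx] using h
  · rintro ⟨hx, h⟩
    have hxF : x ∈ pZp p \ finiteExpansion p :=
      ⟨hx, notMem_finiteExpansion_of_tendsto p (inv_ne_zero hm.ne') h⟩
    refine ⟨hxF, ?_⟩
    have := tendsto_position_div_of_tendsto_count_div (strictMono_blockEnd p hxF)
      (fun k => (iterate_shift_blockEnd p hxF k).2) (inv_ne_zero hm.ne') h
    simpa only [cast_blockEnd p hxF, inv_inv] using this

theorem levelSet_eq_meanSet (α : ℝ) : levelSet p α = meanSet p (α / Real.log p) := by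
  have hl : Real.log p ≠ 0 := (Real.log_pos (one_lt_cast_prime p)).ne'
  have key : ∀ x n, birkhoffAverage ℝ (schneiderMap p) (fun y => Real.log (psi p y)) n x
      = ((∑ i ∈ Finset.range n, (digitA p i x : ℝ)) / n) * Real.log p := by
    intro x n
    simp only [birkhoffAverage, birkhoffSum, psi, Real.log_zpow, digitA, smul_eq_mul,
      ← Finset.sum_mul]
    ring
  ext x
  refine and_congr_right fun _ => ?_
  simp only [HasLyapunovExponent, key]
  constructor
  · intro h
    simpa [hl] using h.div_const (Real.log p)
  · intro h
    simpa [hl] using h.mul_const (Real.log p)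

end Schneider

namespace Schneider

/-! ### Bernoulli measures on digit sequences -/

section Bernoulli

open MeasureTheory Measure

variable {p : ℕ}

/-- The probability measure on `Fin p` with weights `q`. -/
noncomputable def weightPMF (q : Fin p → ℝ) (hq : ∀ b, 0 ≤ q b) (hsum : ∑ b, q b = 1) :
    PMF (Fin p) :=
  PMF.ofFintype (fun b => ENNReal.ofReal (q b)) (by
    rw [← ENNReal.ofReal_sum_of_nonneg fun b _ => hq b, hsum, ENNReal.ofReal_one])

/-- The Bernoulli measure on sequences of digits with weights `q`. -/
noncomputable def bernoulli (q : Fin p → ℝ) (hq : ∀ b, 0 ≤ q b) (hsum : ∑ b, q b = 1) :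
    Measure (ℕ → Fin p) :=
  infinitePi fun _ => (weightPMF q hq hsum).toMeasure

instance isProbabilityMeasure_bernoulli (q : Fin p → ℝ) (hq : ∀ b, 0 ≤ q b) (hsum : ∑ b, q b = 1) :
    IsProbabilityMeasure (bernoulli q hq hsum) := by
  unfold bernoulli
  infer_instance

theorem bernoulli_cylinder (q : Fin p → ℝ) (hq : ∀ b, 0 ≤ q b) (hsum : ∑ b, q b = 1)
    (w : ℕ → Fin p) (n : ℕ) :
    bernoulli q hq hsum {w' | ∀ i < n, w' i = w i}
      = ENNReal.ofReal (∏ i ∈ Finset.range n, q (w i)) := by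
  have : {w' : ℕ → Fin p | ∀ i < n, w' i = w i}
      = Set.pi (Finset.range n) fun i => {w i} := by
    ext w'
    simp [Set.mem_pi]
  rw [this, bernoulli, infinitePi_pi _ fun i _ => measurableSet_singleton _,
    ENNReal.ofReal_prod_of_nonneg fun i _ => hq _]
  refine Finset.prod_congr rfl fun i _ => ?_
  rw [PMF.toMeasure_apply_singleton _ _ (measurableSet_singleton _)]
  rfl

end Bernoulli

variable (p : ℕ) [Fact p.Prime]

/-! ### Hausdorff dimension and the masses of cylinders -/

section Dimension

open MeasureTheory Measure ProbabilityTheory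

variable {p}

theorem dist_le_of_code_eq {x y : ℚ_[p]} (hx : x ∈ pZp p) (hy : y ∈ pZp p) {n : ℕ}
    (h : ∀ i < n, code p x i = code p y i) : dist x y ≤ ((p : ℝ)⁻¹) ^ n := by
  rw [dist_eq_norm]
  exact ((forall_code_eq_iff p n hx hy).1 h).le

theorem inv_cast_prime_mem_Ioo : (p : ℝ)⁻¹ ∈ Set.Ioo (0 : ℝ) 1 :=
  ⟨inv_pos.2 (cast_prime_pos p), inv_lt_one_of_one_lt₀ (one_lt_cast_prime p)⟩

/-- If the cylinder of rank `n` around each point of `E` eventually has mass at least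
`p ^ (-n s)`, then there are at most `p ^ (n s)` such cylinders, so `E` has dimension at most
`s`. -/
theorem dimH_le_of_le_prod {E : Set ℚ_[p]} (hE : E ⊆ pZp p) {q : Fin p → ℝ}
    (hq : ∀ b, 0 ≤ q b) (hsum : ∑ b, q b = 1) {s : NNReal} (hs : 0 < s)
    (h : ∀ x ∈ E, ∀ᶠ n : ℕ in atTop,
      (((p : ℝ)⁻¹) ^ n) ^ (s : ℝ) ≤ ∏ i ∈ Finset.range n, q (code p x i)) :
    dimH E ≤ s := by
  have hp := (inv_cast_prime_mem_Ioo (p := p)).1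
  let EN : ℕ → Set ℚ_[p] := fun N => {x ∈ E | ∀ n ≥ N,
    (((p : ℝ)⁻¹) ^ n) ^ (s : ℝ) ≤ ∏ i ∈ Finset.range n, q (code p x i)}
  have hcover : E ⊆ ⋃ N, EN N := fun x hx => by
    obtain ⟨N, hN⟩ := eventually_atTop.1 (h x hx)
    exact Set.mem_iUnion.2 ⟨N, hx, hN⟩
  refine (dimH_mono hcover).trans ?_
  rw [dimH_iUnion]
  refine iSup_le fun N => ?_
  borelize ℚ_[p]
  refine dimH_le_of_hausdorffMeasure_ne_top (ne_top_of_le_ne_top ENNReal.one_ne_top ?_)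
  let t : ∀ n : ℕ, (Fin n → Fin p) → Set ℚ_[p] := fun n u =>
    {x ∈ EN N | ∀ i : Fin n, code p x i = u i}
  have hdiam : ∀ n u, Metric.ediam (t n u) ≤ ENNReal.ofReal (((p : ℝ)⁻¹) ^ n) := fun n u =>
    Metric.ediam_le_of_forall_dist_le fun x hx y hy =>
      dist_le_of_code_eq (hE hx.1.1) (hE hy.1.1) fun i hi =>
        (hx.2 ⟨i, hi⟩).trans (hy.2 ⟨i, hi⟩).symm
  have hr : Tendsto (fun n : ℕ => ENNReal.ofReal (((p : ℝ)⁻¹) ^ n)) atTop (𝓝 0) := by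
    rw [← ENNReal.ofReal_zero]
    exact ENNReal.tendsto_ofReal
      (tendsto_pow_atTop_nhds_zero_of_lt_one hp.le inv_cast_prime_mem_Ioo.2)
  refine (hausdorffMeasure_le_liminf_sum (s : ℝ) (EN N) _ hr t
    (Eventually.of_forall hdiam) (Eventually.of_forall fun n x hx =>
      Set.mem_iUnion.2 ⟨fun i => code p x i, hx, fun _ => rfl⟩)).trans ?_
  refine (liminf_le_liminf (v := fun _ => (1 : ENNReal)) ?_).trans (by simp)
  filter_upwards [eventually_ge_atTop N] with n hn
  have hterm : ∀ u : Fin n → Fin p,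
      Metric.ediam (t n u) ^ (s : ℝ) ≤ ENNReal.ofReal (∏ i, q (u i)) := by
    intro u
    rcases (t n u).eq_empty_or_nonempty with he | ⟨x, hx⟩
    · rw [he, Metric.ediam_empty, ENNReal.zero_rpow_of_pos (by exact_mod_cast hs)]
      exact zero_le
    · calc Metric.ediam (t n u) ^ (s : ℝ) ≤ ENNReal.ofReal (((p : ℝ)⁻¹) ^ n) ^ (s : ℝ) := by
            gcongr
            exact hdiam n u
        _ = ENNReal.ofReal ((((p : ℝ)⁻¹) ^ n) ^ (s : ℝ)) :=
            ENNReal.ofReal_rpow_of_pos (pow_pos hp n)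
        _ ≤ ENNReal.ofReal (∏ i, q (u i)) := by
            refine ENNReal.ofReal_le_ofReal ((hx.1.2 n hn).trans_eq ?_)
            rw [Finset.prod_range]
            exact Finset.prod_congr rfl fun i _ => by rw [hx.2 i]
  calc ∑ u, Metric.ediam (t n u) ^ (s : ℝ) ≤ ∑ u : Fin n → Fin p, ENNReal.ofReal (∏ i, q (u i)) :=
        Finset.sum_le_sum fun u _ => hterm u
    _ = ENNReal.ofReal ((∑ b, q b) ^ n) := by
        rw [← ENNReal.ofReal_sum_of_nonneg fun u _ => Finset.prod_nonneg fun i _ => hq _,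
          Fintype.sum_pow]
    _ = 1 := by rw [hsum, one_pow, ENNReal.ofReal_one]

/-- The point with a given digit sequence. -/
noncomputable def decode (w : ℕ → Fin p) : ℚ_[p] := (exists_code_eq p w).choose

theorem decode_mem (w : ℕ → Fin p) : decode w ∈ pZp p := (exists_code_eq p w).choose_spec.1

theorem code_decode (w : ℕ → Fin p) : code p (decode w) = w :=
  (exists_code_eq p w).choose_spec.2

theorem continuous_decode : Continuous (decode : (ℕ → Fin p) → ℚ_[p]) := by
  rw [Metric.continuous_iff']
  intro w ε hε
  obtain ⟨n, hn⟩ := exists_pow_lt_of_lt_one hε (inv_cast_prime_mem_Ioo (p := p)).2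
  have : ∀ᶠ w' in 𝓝 w, ∀ i ∈ Finset.range n, w' i = w i := by
    rw [Finset.eventually_all]
    intro i _
    exact (continuous_apply i).continuousAt.eventually (isOpen_discrete {w i} |>.mem_nhds rfl)
  filter_upwards [this] with w' hw'
  refine (dist_le_of_code_eq (decode_mem _) (decode_mem _) fun i hi => ?_).trans_lt hn
  rw [code_decode, code_decode]
  exact hw' i (Finset.mem_range.2 hi)

/-- Mass distribution principle: if almost every digit sequence decodes to a point of `E`, and
the cylinders of rank `n` around it eventually have mass at most `p ^ (-n s)`, then `E` has
dimension at least `s`. -/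
theorem le_dimH_of_prod_le {E : Set ℚ_[p]} {q : Fin p → ℝ}
    (hq : ∀ b, 0 ≤ q b) (hsum : ∑ b, q b = 1) {s : NNReal} (hs : 0 < s)
    (hE : ∀ᵐ w ∂bernoulli q hq hsum, decode w ∈ E)
    (h : ∀ᵐ w ∂bernoulli q hq hsum, ∀ᶠ n : ℕ in atTop,
      ∏ i ∈ Finset.range n, q (w i) ≤ (((p : ℝ)⁻¹) ^ n) ^ (s : ℝ)) :
    s ≤ dimH E := by
  have hp := (inv_cast_prime_mem_Ioo (p := p)).1
  have hp1 := (inv_cast_prime_mem_Ioo (p := p)).2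
  have hsR : (0 : ℝ) < s := by exact_mod_cast hs
  set P := bernoulli q hq hsum with hP
  let W : ℕ → Set (ℕ → Fin p) := fun N => {w | ∀ n ≥ N,
    ∏ i ∈ Finset.range n, q (w i) ≤ (((p : ℝ)⁻¹) ^ n) ^ (s : ℝ)}
  obtain ⟨N, hN⟩ : ∃ N, P (decode ⁻¹' E ∩ W N) ≠ 0 := by
    by_contra! h0
    have hnull := measure_iUnion_null h0
    have hae : ∀ᵐ w ∂P, w ∈ ⋃ N, decode ⁻¹' E ∩ W N := by
      filter_upwards [hE, h] with w hw1 hw2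
      obtain ⟨N, hN⟩ := eventually_atTop.1 hw2
      exact Set.mem_iUnion.2 ⟨N, hw1, hN⟩
    have huniv := prob_compl_eq_zero_iff₀ (μ := P) (.of_null hnull) |>.1 hae
    rw [hnull] at huniv
    exact zero_ne_one huniv
  borelize ℚ_[p]
  have hmeas : Measurable (decode : (ℕ → Fin p) → ℚ_[p]) := continuous_decode.measurable
  set ν := (P.restrict (W N)).map decode with hν
  -- A set of diameter less than `p ^ (-n)` meets the image of only one cylinder of rank `n`.
  have hball : ∀ n ≥ N, ∀ A : Set ℚ_[p], Metric.ediam A < ENNReal.ofReal (((p : ℝ)⁻¹) ^ n) →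
      ν A ≤ ENNReal.ofReal ((((p : ℝ)⁻¹) ^ n) ^ (s : ℝ)) := by
    intro n hn A hA
    refine (measure_mono subset_closure).trans ?_
    rw [hν, map_apply hmeas isClosed_closure.measurableSet,
      restrict_apply (hmeas isClosed_closure.measurableSet)]
    rcases (decode ⁻¹' closure A ∩ W N).eq_empty_or_nonempty with he | ⟨w, hwA, hwW⟩
    · rw [he, measure_empty]
      exact zero_le
    · have hsub : decode ⁻¹' closure A ∩ W N ⊆ {w' | ∀ i < n, w' i = w i} := by
        rintro w' ⟨hw', -⟩
        have hd : edist (decode w') (decode w) < ENNReal.ofReal (((p : ℝ)⁻¹) ^ n) := by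
          refine (Metric.edist_le_ediam_of_mem (s := closure A) hw' hwA).trans_lt ?_
          rwa [Metric.ediam_closure]
        change ∀ i < n, w' i = w i
        rw [edist_dist, ENNReal.ofReal_lt_ofReal_iff (pow_pos hp n), dist_eq_norm] at hd
        simpa only [code_decode] using
          (forall_code_eq_iff p n (decode_mem w') (decode_mem w)).2 hd
      refine (measure_mono hsub).trans ?_
      rw [hP, bernoulli_cylinder]
      exact ENNReal.ofReal_le_ofReal (hwW n hn)
  -- The factor `p ^ (-2 s)` makes up for rounding the diameter of a set to a power of `p`.
  set c : ENNReal := ENNReal.ofReal ((((p : ℝ)⁻¹) ^ 2) ^ (s : ℝ)) with hc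
  have hc0 : c ≠ 0 := by
    rw [hc, ENNReal.ofReal_ne_zero_iff]
    positivity
  have hle : c • ν ≤ μH[(s : ℝ)] := by
    refine le_hausdorffMeasure _ _ (ENNReal.ofReal (((p : ℝ)⁻¹) ^ (N + 2)))
      (ENNReal.ofReal_pos.2 (pow_pos hp _)) fun A hA => ?_
    rw [Measure.smul_apply, smul_eq_mul]
    obtain hd | hd := eq_or_ne (Metric.ediam A) 0
    · have hz : ν A = 0 := by
        have hlim : Tendsto (fun n : ℕ => ENNReal.ofReal ((((p : ℝ)⁻¹) ^ n) ^ (s : ℝ)))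
            atTop (𝓝 0) := by
          have h1 := (tendsto_pow_atTop_nhds_zero_of_lt_one hp.le hp1).rpow_const
            (p := (s : ℝ)) (Or.inr hsR.le)
          rw [Real.zero_rpow hsR.ne'] at h1
          simpa using ENNReal.tendsto_ofReal h1
        refine nonpos_iff_eq_zero.1 (ge_of_tendsto hlim ?_)
        filter_upwards [eventually_ge_atTop N] with n hn
        refine hball n hn A ?_
        rw [hd]
        exact ENNReal.ofReal_pos.2 (pow_pos hp n)
      rw [hz, mul_zero]
      exact zero_le
    · have htop : Metric.ediam A ≠ ⊤ := ne_top_of_le_ne_top ENNReal.ofReal_ne_top hA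
      set r := (Metric.ediam A).toReal with hr
      have hrA : Metric.ediam A = ENNReal.ofReal r := (ENNReal.ofReal_toReal htop).symm
      have hr0 : 0 < r := ENNReal.toReal_pos hd htop
      have hrN : r ≤ ((p : ℝ)⁻¹) ^ (N + 2) := by
        rwa [hrA, ENNReal.ofReal_le_ofReal_iff (by positivity)] at hA
      obtain ⟨k, hk1, hk2⟩ := exists_nat_pow_near_of_lt_one hr0
        (hrN.trans (pow_le_one₀ hp.le hp1.le)) hp hp1
      have hkN : N + 2 < k + 1 := (pow_lt_pow_iff_right_of_lt_one₀ hp hp1).1 (hk1.trans_le hrN)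
      obtain ⟨n, rfl⟩ : ∃ n, k = n + 1 := ⟨k - 1, by omega⟩
      have hb := hball n (by omega) A (by
        rw [hrA, ENNReal.ofReal_lt_ofReal_iff (pow_pos hp n)]
        exact hk2.trans_lt (pow_lt_pow_right_of_lt_one₀ hp hp1 n.lt_succ_self))
      calc c * ν A ≤ c * ENNReal.ofReal ((((p : ℝ)⁻¹) ^ n) ^ (s : ℝ)) := by gcongr
        _ = ENNReal.ofReal ((((p : ℝ)⁻¹) ^ (n + 1 + 1)) ^ (s : ℝ)) := by
            rw [hc, ← ENNReal.ofReal_mul (by positivity),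
              ← Real.mul_rpow (by positivity) (by positivity), ← pow_add]
            congr 3
            omega
        _ ≤ ENNReal.ofReal (r ^ (s : ℝ)) := by gcongr
        _ = Metric.ediam A ^ (s : ℝ) := by rw [hrA, ENNReal.ofReal_rpow_of_pos hr0]
  refine le_dimH_of_hausdorffMeasure_ne_zero fun h0 => ?_
  have h1 : c * ν E ≤ 0 := h0 ▸ hle E
  have h2 : ν E = 0 := by
    have := nonpos_iff_eq_zero.1 h1
    exact (mul_eq_zero.1 this).resolve_left hc0
  refine hN (nonpos_iff_eq_zero.1 ?_)
  calc P (decode ⁻¹' E ∩ W N) ≤ P.restrict (W N) (decode ⁻¹' E) := le_restrict_apply _ _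
    _ ≤ ν E := le_map_apply hmeas.aemeasurable E
    _ = 0 := h2

end Dimension

end Schneider

namespace Schneider

/-! ### Sequences with a given density of nonzero digits -/

section Weights

open MeasureTheory Measure ProbabilityTheory

variable {p : ℕ}

/-- The weights on `{0, …, p - 1}` which are `1 - t` at `0` and `t / (p - 1)` at each nonzero
digit. -/
noncomputable def digitWeight (p : ℕ) (t : ℝ) (b : Fin p) : ℝ :=
  if (b : ℕ) = 0 then 1 - t else t / (p - 1)

/-- For `0 < t < 1`, the limit of `-(1/n) log` of the mass of the cylinder of rank `n` for
`digitWeight p t`, around a sequence whose nonzero digits have density `δ`. -/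
noncomputable def crossEntropy (p : ℕ) (t δ : ℝ) : ℝ :=
  -((1 - δ) * Real.log (1 - t) + δ * Real.log (t / (p - 1)))

theorem digitWeight_nonneg [Fact p.Prime] {t : ℝ} (h0 : 0 ≤ t) (h1 : t ≤ 1) (b : Fin p) :
    0 ≤ digitWeight p t b := by
  have := one_lt_cast_prime p
  unfold digitWeight
  split_ifs
  · linarith
  · exact div_nonneg h0 (by linarith)

/-- The mean, under the weights, of a function of whether the digit is nonzero. -/
theorem sum_digitWeight_mul [Fact p.Prime] (t : ℝ) (f : Bool → ℝ) :
    ∑ b : Fin p, digitWeight p t b * f (decide ((b : ℕ) ≠ 0)) = (1 - t) * f false + t * f true := by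
  have hp := one_lt_cast_prime p
  obtain ⟨k, hk⟩ : ∃ k, p = k + 1 := ⟨p - 1, by have := (Fact.out : p.Prime).pos; omega⟩
  have hk0 : (k : ℝ) ≠ 0 := by
    rintro h
    rw [hk] at hp
    push_cast at hp
    linarith
  have hsum : ∀ g : ℕ → ℝ, ∑ b : Fin p, g b = g 0 + ∑ i ∈ Finset.range k, g (i + 1) := by
    intro g
    rw [Fin.sum_univ_eq_sum_range g, hk, Finset.sum_range_succ', add_comm]
  have := hsum fun b => (if b = 0 then 1 - t else t / (p - 1)) * f (decide (b ≠ 0))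
  simp only [digitWeight]
  rw [this]
  simp [hk]
  field_simp

theorem sum_digitWeight [Fact p.Prime] (t : ℝ) : ∑ b : Fin p, digitWeight p t b = 1 := by
  simpa using sum_digitWeight_mul (p := p) t fun _ => 1

/-- For `0 < t < 1`, the logarithm of the mass of the cylinder of rank `n` around `w` for
`digitWeight p t`, written in terms of the number of nonzero digits. -/
noncomputable def logMass (t : ℝ) (w : ℕ → Fin p) (n : ℕ) : ℝ :=
  (n - nonzeroCount w n) * Real.log (1 - t) + nonzeroCount w n * Real.log (t / (p - 1))

theorem logMass_succ (t : ℝ) (w : ℕ → Fin p) (n : ℕ) :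
    logMass t w (n + 1) = logMass t w n + Real.log (digitWeight p t (w n)) := by
  unfold logMass digitWeight nonzeroCount
  rw [Nat.count_succ]
  by_cases h : (w n : ℕ) = 0
  · rw [if_neg (not_not.2 h), if_pos h]
    push_cast
    ring
  · rw [if_pos h, if_neg h]
    push_cast
    ring

theorem prod_digitWeight_eq_exp [Fact p.Prime] {t : ℝ} (h0 : 0 < t) (h1 : t < 1) (w : ℕ → Fin p)
    (n : ℕ) : ∏ i ∈ Finset.range n, digitWeight p t (w i) = Real.exp (logMass t w n) := by
  induction n with
  | zero => simp [logMass, nonzeroCount]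
  | succ n ih =>
    have : 0 < digitWeight p t (w n) := by
      have := one_lt_cast_prime p
      unfold digitWeight
      split_ifs
      · linarith
      · exact div_pos h0 (by linarith)
    rw [Finset.prod_range_succ, ih, logMass_succ, Real.exp_add, Real.exp_log this]

/-- For `t = 1` the digit `0` has weight `0`, and `Real.log 0 = 0` makes the right side an upper
bound. -/
theorem prod_digitWeight_le_exp [Fact p.Prime] {t : ℝ} (h0 : 0 ≤ t) (h1 : t ≤ 1) (w : ℕ → Fin p)
    (n : ℕ) : ∏ i ∈ Finset.range n, digitWeight p t (w i) ≤ Real.exp (logMass t w n) := by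
  induction n with
  | zero => simp [logMass, nonzeroCount]
  | succ n ih =>
    rw [Finset.prod_range_succ, logMass_succ, Real.exp_add]
    exact mul_le_mul ih (Real.le_exp_log _) (digitWeight_nonneg h0 h1 _) (Real.exp_pos _).le

theorem tendsto_logMass_div {t δ : ℝ} {w : ℕ → Fin p}
    (h : Tendsto (fun n : ℕ => (nonzeroCount w n : ℝ) / n) atTop (𝓝 δ)) :
    Tendsto (fun n : ℕ => logMass t w n / n) atTop (𝓝 (-crossEntropy p t δ)) := by
  rw [crossEntropy, neg_neg]
  refine (((tendsto_const_nhds.sub h).mul_const _).add (h.mul_const _)).congr' ?_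
  filter_upwards [eventually_gt_atTop 0] with n hn
  have : (n : ℝ) ≠ 0 := by positivity
  unfold logMass
  field_simp

theorem inv_pow_rpow_eq_exp [Fact p.Prime] (n : ℕ) (s : ℝ) :
    (((p : ℝ)⁻¹) ^ n) ^ s = Real.exp (-(s * Real.log p) * n) := by
  have hp := cast_prime_pos p
  rw [Real.rpow_def_of_pos (by positivity), Real.log_pow, Real.log_inv]
  ring_nf

/-- The points of `pℤ_p` whose code has nonzero digits of density `δ`. -/
def densitySet (p : ℕ) [Fact p.Prime] (δ : ℝ) : Set ℚ_[p] :=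
  {x | x ∈ pZp p ∧ Tendsto (fun n : ℕ => (nonzeroCount (code p x) n : ℝ) / n) atTop (𝓝 δ)}

theorem dimH_densitySet_le [Fact p.Prime] {t δ : ℝ} (h0 : 0 < t) (h1 : t < 1) {s : NNReal}
    (hs : 0 < s) (h : crossEntropy p t δ < s * Real.log p) : dimH (densitySet p δ) ≤ s := by
  refine dimH_le_of_le_prod (fun x hx => hx.1) (digitWeight_nonneg h0.le h1.le)
    (sum_digitWeight t) hs fun x hx => ?_
  filter_upwards [(tendsto_logMass_div (t := t) hx.2).eventually_const_lt (neg_lt_neg h),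
    eventually_gt_atTop 0] with n hn hn0
  rw [prod_digitWeight_eq_exp h0 h1, inv_pow_rpow_eq_exp, Real.exp_le_exp]
  exact ((lt_div_iff₀ (by positivity)).1 hn).le

theorem ae_tendsto_nonzeroCount_div [Fact p.Prime] {t : ℝ} (h0 : 0 ≤ t) (h1 : t ≤ 1) :
    ∀ᵐ w ∂bernoulli (digitWeight p t) (digitWeight_nonneg h0 h1) (sum_digitWeight t),
      Tendsto (fun n : ℕ => (nonzeroCount w n : ℝ) / n) atTop (𝓝 t) := by
  set P := bernoulli (digitWeight p t) (digitWeight_nonneg h0 h1) (sum_digitWeight t) with hP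
  let f : Fin p → ℝ := fun b => if (b : ℕ) ≠ 0 then 1 else 0
  let X : ℕ → (ℕ → Fin p) → ℝ := fun i w => f (w i)
  have hf : Measurable f := measurable_of_finite f
  have hmp : ∀ i, MeasurePreserving (Function.eval i) P
      (weightPMF (digitWeight p t) (digitWeight_nonneg h0 h1) (sum_digitWeight t)).toMeasure :=
    fun i => measurePreserving_eval_infinitePi _ i
  have hXm : ∀ i, Measurable (X i) := fun i => hf.comp (measurable_pi_apply i)
  have hind : iIndepFun X P := iIndepFun_infinitePi fun _ => hf
  have hident : ∀ i, IdentDistrib (X i) (X 0) P P := fun i =>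
    (IdentDistrib.mk (measurable_pi_apply i).aemeasurable (measurable_pi_apply 0).aemeasurable
      ((hmp i).map_eq.trans (hmp 0).map_eq.symm)).comp hf
  have hint : Integrable (X 0) P := by
    refine Integrable.of_bound (hXm 0).aestronglyMeasurable 1 (Eventually.of_forall fun w => ?_)
    simp only [X, f]
    split_ifs <;> simp
  have hmean : ∫ w, X 0 w ∂P = t := by
    have h := integral_map (μ := P) (φ := Function.eval 0) (f := f)
      (hmp 0).measurable.aemeasurable hf.aestronglyMeasurable
    rw [(hmp 0).map_eq, PMF.integral_eq_sum] at h
    refine h.symm.trans ?_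
    have hsum := sum_digitWeight_mul (p := p) t fun b => if b then 1 else 0
    simp only [decide_eq_true_eq, Bool.false_eq_true, if_false, if_true, mul_zero, zero_add,
      mul_one] at hsum
    refine Eq.trans (Finset.sum_congr rfl fun b _ => ?_) hsum
    rw [smul_eq_mul, weightPMF, PMF.ofFintype_apply,
      ENNReal.toReal_ofReal (digitWeight_nonneg h0 h1 b)]
  have hslln := strong_law_ae_real X hint (fun i j hij => hind.indepFun hij) hident
  rw [hmean] at hslln
  filter_upwards [hslln] with w hw
  refine hw.congr fun n => ?_
  congr 1
  rw [nonzeroCount, Nat.count_eq_card_filter_range, Finset.card_filter]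
  push_cast
  rfl

theorem ae_decode_mem_densitySet [Fact p.Prime] {t : ℝ} (h0 : 0 ≤ t) (h1 : t ≤ 1) :
    ∀ᵐ w ∂bernoulli (digitWeight p t) (digitWeight_nonneg h0 h1) (sum_digitWeight t),
      decode w ∈ densitySet p t := by
  filter_upwards [ae_tendsto_nonzeroCount_div h0 h1] with w hw
  refine ⟨decode_mem w, ?_⟩
  rwa [code_decode]

theorem nonempty_densitySet [Fact p.Prime] {t : ℝ} (h0 : 0 ≤ t) (h1 : t ≤ 1) :
    (densitySet p t).Nonempty := by
  obtain ⟨w, hw⟩ := (ae_decode_mem_densitySet (p := p) h0 h1).exists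
  exact ⟨_, hw⟩

theorem le_dimH_densitySet [Fact p.Prime] {t : ℝ} (h0 : 0 ≤ t) (h1 : t ≤ 1) {s : NNReal}
    (hs : 0 < s) (h : s * Real.log p < crossEntropy p t t) : s ≤ dimH (densitySet p t) := by
  refine le_dimH_of_prod_le (digitWeight_nonneg h0 h1) (sum_digitWeight t) hs
    (ae_decode_mem_densitySet h0 h1) ?_
  filter_upwards [ae_tendsto_nonzeroCount_div h0 h1] with w hw
  filter_upwards [(tendsto_logMass_div (t := t) hw).eventually_lt_const (neg_lt_neg h),
    eventually_gt_atTop 0] with n hn hn0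
  refine (prod_digitWeight_le_exp h0 h1 w n).trans ?_
  rw [inv_pow_rpow_eq_exp, Real.exp_le_exp]
  exact ((div_lt_iff₀ (by positivity)).1 hn).le

theorem crossEntropy_self [Fact p.Prime] {t : ℝ} (h0 : 0 < t) :
    crossEntropy p t t = Real.qaryEntropy p t := by
  have hp := one_lt_cast_prime p
  rw [crossEntropy, Real.qaryEntropy, Real.binEntropy, Real.log_div h0.ne' (by linarith),
    Real.log_inv, Real.log_inv]
  push_cast
  ring

/-- At density `δ = 1` the weights `digitWeight p 1` charge no cylinder with a digit `0`, so the
upper bound needs weights with `t < 1` close to `1`. -/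
theorem exists_crossEntropy_lt [Fact p.Prime] {δ c : ℝ} (h0 : 0 < δ) (h1 : δ ≤ 1)
    (hc : Real.qaryEntropy p δ < c) : ∃ t, 0 < t ∧ t < 1 ∧ crossEntropy p t δ < c := by
  obtain hlt | rfl := h1.lt_or_eq
  · exact ⟨δ, h0, hlt, by rwa [crossEntropy_self h0]⟩
  · have hp := one_lt_cast_prime p
    have hcont : ContinuousAt (fun t : ℝ => -Real.log (t / (p - 1))) 1 :=
      ((continuousAt_id.div_const _).log (by
        simpa using (sub_pos.2 hp).ne')).neg
    have hev : ∀ᶠ t in 𝓝[<] (1 : ℝ), -Real.log (t / (p - 1)) < c := by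
      refine (hcont.mono_left nhdsWithin_le_nhds).eventually_lt_const ?_
      change -Real.log (1 / ((p : ℝ) - 1)) < c
      rw [one_div, Real.log_inv, neg_neg]
      simpa using hc
    obtain ⟨t, ht, ht'⟩ := (hev.and (Ioo_mem_nhdsLT zero_lt_one)).exists
    refine ⟨t, ht'.1, ht'.2, ?_⟩
    simpa [crossEntropy] using ht

/-- Besicovitch–Eggleston theorem for the density of nonzero digits. -/
theorem dimH_densitySet [Fact p.Prime] {δ : ℝ} (h0 : 0 < δ) (h1 : δ ≤ 1) :
    dimH (densitySet p δ) = ENNReal.ofReal (Real.qaryEntropy p δ / Real.log p) := by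
  have hp := one_lt_cast_prime p
  have hlog : 0 < Real.log p := Real.log_pos hp
  have hD : 0 ≤ Real.qaryEntropy p δ / Real.log p :=
    div_nonneg (Real.qaryEntropy_nonneg h0.le h1) hlog.le
  refine le_antisymm (le_of_not_gt fun hlt => ?_) (le_of_not_gt fun hlt => ?_)
  · obtain ⟨s, hs1, hs2⟩ := ENNReal.lt_iff_exists_nnreal_btwn.1 hlt
    have hDs : Real.qaryEntropy p δ / Real.log p < s := by
      rw [← ENNReal.ofReal_coe_nnreal] at hs1
      exact (ENNReal.ofReal_lt_ofReal_iff_of_nonneg hD).1 hs1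
    obtain ⟨t, ht0, ht1, ht⟩ := exists_crossEntropy_lt h0 h1 ((div_lt_iff₀ hlog).1 hDs)
    exact hs2.not_ge (dimH_densitySet_le ht0 ht1 (by exact_mod_cast hD.trans_lt hDs) ht)
  · obtain ⟨s, hs1, hs2⟩ := ENNReal.lt_iff_exists_nnreal_btwn.1 hlt
    have hDs : s < Real.qaryEntropy p δ / Real.log p := by
      rw [← ENNReal.ofReal_coe_nnreal] at hs2
      exact (ENNReal.ofReal_lt_ofReal_iff_of_nonneg s.2).1 hs2
    refine hs1.not_ge (le_dimH_densitySet h0.le h1 (by exact_mod_cast zero_le.trans_lt hs1) ?_)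
    rw [crossEntropy_self h0]
    exact (lt_div_iff₀ hlog).1 hDs

end Weights

end Schneider

namespace Schneider

/-! ### The Lyapunov spectrum -/

section Spectrum

variable (p : ℕ) [Fact p.Prime]

theorem meanSet_eq_densitySet {m : ℝ} (hm : 0 < m) : meanSet p m = densitySet p m⁻¹ :=
  Set.ext fun _ => mem_meanSet_iff p hm

theorem dimH_meanSet {m : ℝ} (hm : 1 ≤ m) :
    (dimH (meanSet p m) : EReal) = ((Real.qaryEntropy p m⁻¹ / Real.log p : ℝ) : EReal) := by
  have h0 : 0 < m := zero_lt_one.trans_le hm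
  have h1 : m⁻¹ ≤ 1 := inv_le_one_of_one_le₀ hm
  rw [meanSet_eq_densitySet p h0, dimH_densitySet (inv_pos.2 h0) h1, EReal.coe_ennreal_ofReal,
    max_eq_left]
  exact div_nonneg (Real.qaryEntropy_nonneg (inv_pos.2 h0).le h1)
    (Real.log_pos (one_lt_cast_prime p)).le

theorem qaryEntropy_inv {m : ℝ} (hm : 1 < m) :
    Real.qaryEntropy p m⁻¹ / Real.log p
      = (m * Real.log m - (m - 1) * Real.log (m - 1) + Real.log ((p : ℝ) - 1))
        / (m * Real.log p) := by
  have h0 : m ≠ 0 := by linarith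
  have h1 : m - 1 ≠ 0 := by linarith
  have hl : Real.log p ≠ 0 := (Real.log_pos (one_lt_cast_prime p)).ne'
  have h2 : (1 - m⁻¹)⁻¹ = m / (m - 1) := by field_simp
  rw [Real.qaryEntropy, Real.binEntropy, inv_inv, h2, Real.log_div h0 h1]
  push_cast
  field_simp
  ring

theorem qaryEntropy_inv_one (q : ℕ) :
    Real.qaryEntropy q (1 : ℝ)⁻¹ / Real.log q = Real.log ((q : ℝ) - 1) / Real.log q := by
  rw [inv_one, Real.qaryEntropy_one]
  push_cast
  rfl

end Spectrum

end Schneider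

theorem theorem1p2 (p : ℕ) [Fact p.Prime] :
    (∀ α : ℝ, Real.log p ≤ α → (Schneider.levelSet p α).Nonempty) ∧
    (∀ α : ℝ, Real.log p < α →
      (Schneider.lyapunovSpectrum p α : EReal) =
        (((Real.log ((p : ℝ) - 1) + Real.log (α - Real.log p) - Real.log (Real.log p)
            + α * Real.logb p α - α * Real.logb p (α - Real.log p)) / α : ℝ) : EReal)) ∧
    ((Schneider.lyapunovSpectrum p (Real.log p) : EReal) =
        ((Real.log ((p : ℝ) - 1) / Real.log p : ℝ) : EReal)) ∧
    (∀ m : ℝ, 1 < m →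
      (dimH (Schneider.meanSet p m) : EReal) =
        (((m * Real.log m - (m - 1) * Real.log (m - 1) + Real.log ((p : ℝ) - 1))
            / (m * Real.log p) : ℝ) : EReal)) ∧
    ((dimH (Schneider.meanSet p 1) : EReal) =
        ((Real.log ((p : ℝ) - 1) / Real.log p : ℝ) : EReal)) := by
  have hl : 0 < Real.log p := Real.log_pos (Schneider.one_lt_cast_prime p)
  refine ⟨fun α hα => ?_, fun α hα => ?_, ?_, fun m hm => ?_, ?_⟩
  · have hm : 1 ≤ α / Real.log p := (one_le_div hl).2 hα
    have h0 : 0 < α / Real.log p := zero_lt_one.trans_le hm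
    rw [Schneider.levelSet_eq_meanSet, Schneider.meanSet_eq_densitySet p h0]
    exact Schneider.nonempty_densitySet (inv_pos.2 h0).le (inv_le_one_of_one_le₀ hm)
  · have hm : 1 < α / Real.log p := (one_lt_div hl).2 hα
    have hα0 : α ≠ 0 := (hl.trans hα).ne'
    rw [Schneider.lyapunovSpectrum, Schneider.levelSet_eq_meanSet, Schneider.dimH_meanSet p hm.le,
      Schneider.qaryEntropy_inv p hm, div_sub_one hl.ne', Real.log_div hα0 hl.ne',
      Real.log_div (sub_pos.2 hα).ne' hl.ne', Real.logb, Real.logb]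
    congr 1
    field_simp
    ring
  · rw [Schneider.lyapunovSpectrum, Schneider.levelSet_eq_meanSet, div_self hl.ne',
      Schneider.dimH_meanSet p le_rfl, Schneider.qaryEntropy_inv_one]
  · rw [Schneider.dimH_meanSet p hm.le, Schneider.qaryEntropy_inv p hm]
  · rw [Schneider.dimH_meanSet p le_rfl, Schneider.qaryEntropy_inv_one]
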